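/- For $x,y$ in a group write $[x,y]=x^{-1}y^{-1}xy$, and for a subgroup $H$ let $[H,H]$ be the subgroup generated by all $[h,k]$ with $h,k\in H$. Let $(G_n)_{n\in\mathbf N}$ be a sequence of finite groups and let $p$ be a nonprincipal ultrafilter on $\mathbf N$. The ultrafinite group $G=\prod_{n\to p}G_n$ is the group of all sequences $(g_n)\in\prod_n G_n$ up to equality for $p$-almost all $n$. For finite sets $X_n$, a subset of $\prod_{n\to p}X_n$ is called internal if it has the form $\prod_{n\to p}S_n$ with $S_n\subset X_n$, that is, if it consists of the classes of the sequences $(s_n)$ with $s_n\in S_n$ for $p$-almost all $n$. Loeb measure is the countably additive measure on the $\sigma$-algebra generated by the internal sets that extends $\prod_{n\to p}S_n\mapsto\lim_{n\to p}|S_n|/|X_n|$. The set $G^2$ carries the Loeb measure of $\prod_{n\to p}G_n^2$, with which it is identified. (A) Every ultrafinite group $G$ has an internal normal subgroup $H$ such that $[H,H]$ is finite and such that almost every pair $(x,y)\in G^2$ (with respect to Loeb measure on $G^2$) with $[x,y]\in[H,H]$ is contained in $H^2$; that is, the set of $(x,y)\in G^2\setminus H^2$ with $[x,y]\in[H,H]$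 is null. Moreover, (A) is equivalent to the following statement (so that this also holds). (B) For every decreasing function $\eta:\mathbf N\to(0,1)$ there is some $M=M(\eta)$ such that every finite group $G$ has a normal subgroup $H$ with $|[H,H]|\le M$ such that, with at most $\eta(|[H,H]|)\,|G|^2$ exceptions, every pair $(x,y)\in G^2$ with $[x,y]\in[H,H]$ is contained in $H^2$. -/

import Mathlib

open Filter MeasureTheory Topology
open scoped ENNReal

universe u v

/-- The ultraproduct `∏_{n → p} X n`: sequences in `∏ X n` up to `p`-almost-everywhere equality. -/
def Ultraproduct (p : Ultrafilter ℕ) (X : ℕ → Type u) : Type u :=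
  (p : Filter ℕ).Product X

namespace Ultraproduct

/-- The class of a sequence in the ultraproduct. -/
def mk (p : Ultrafilter ℕ) {X : ℕ → Type u} (s : ∀ n, X n) : Ultraproduct p X :=
  Quotient.mk (productSetoid (p : Filter ℕ) X) s

theorem mk_eq_mk {p : Ultrafilter ℕ} {X : ℕ → Type u} {s t : ∀ n, X n} :
    mk p s = mk p t ↔ ∀ᶠ n in (p : Filter ℕ), s n = t n :=
  Quotient.eq (r := productSetoid (p : Filter ℕ) X)

theorem ind {p : Ultrafilter ℕ} {X : ℕ → Type u} {P : Ultraproduct p X → Prop}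
    (h : ∀ s : ∀ n, X n, P (mk p s)) (x : Ultraproduct p X) : P x :=
  Quotient.ind (s := productSetoid (p : Filter ℕ) X) h x

/-- The map of ultraproducts induced by a sequence of maps. -/
def map (p : Ultrafilter ℕ) {X : ℕ → Type u} {Y : ℕ → Type v} (f : ∀ n, X n → Y n) :
    Ultraproduct p X → Ultraproduct p Y :=
  Quotient.map (sa := productSetoid (p : Filter ℕ) X) (sb := productSetoid (p : Filter ℕ) Y)
    (fun s n => f n (s n))
    (fun _ _ h => Filter.Eventually.mono h fun n hn => congrArg (f n) hn)

/-- The binary operation on ultraproducts induced by a sequence of binary operations. -/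
def map₂ (p : Ultrafilter ℕ) {X : ℕ → Type u} {Y : ℕ → Type v} {Z : ℕ → Type*}
    (f : ∀ n, X n → Y n → Z n) : Ultraproduct p X → Ultraproduct p Y → Ultraproduct p Z :=
  Quotient.map₂ (sa := productSetoid (p : Filter ℕ) X) (sb := productSetoid (p : Filter ℕ) Y)
    (sc := productSetoid (p : Filter ℕ) Z)
    (fun s t n => f n (s n) (t n))
    (fun _ _ h _ _ h' => (Filter.Eventually.and h h').mono
      fun n hn => congrArg₂ (f n) hn.1 hn.2)

/-- The ultraproduct of groups is a group, with pointwise operations on representatives. -/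
instance instGroup (p : Ultrafilter ℕ) (G : ℕ → Type u) [∀ n, Group (G n)] :
    Group (Ultraproduct p G) :=
  { mul := map₂ p fun _ a b => a * b
    one := mk p fun _ => 1
    inv := map p fun _ a => a⁻¹
    mul_assoc := fun a b c => by
      induction a using ind
      induction b using ind
      induction c using ind
      exact congrArg (mk p) (funext fun n => mul_assoc _ _ _)
    one_mul := fun a => by
      induction a using ind
      exact congrArg (mk p) (funext fun n => one_mul _)
    mul_one := fun a => by
      induction a using ind
      exact congrArg (mk p) (funext fun n => mul_one _)
    inv_mul_cancel := fun a => by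
      induction a using ind
      exact congrArg (mk p) (funext fun n => inv_mul_cancel _) }

theorem mk_mul (p : Ultrafilter ℕ) {G : ℕ → Type u} [∀ n, Group (G n)] (s t : ∀ n, G n) :
    mk p s * mk p t = mk p (fun n => s n * t n) := rfl

theorem mk_inv (p : Ultrafilter ℕ) {G : ℕ → Type u} [∀ n, Group (G n)] (s : ∀ n, G n) :
    (mk p s)⁻¹ = mk p (fun n => (s n)⁻¹) := rfl

theorem mk_one (p : Ultrafilter ℕ) {G : ℕ → Type u} [∀ n, Group (G n)] :
    (1 : Ultraproduct p G) = mk p (fun _ => 1) := rfl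

/-- The canonical identification of `∏_{n → p} (X n × Y n)` with
`(∏_{n → p} X n) × (∏_{n → p} Y n)`. -/
def prodEquiv (p : Ultrafilter ℕ) (X : ℕ → Type u) (Y : ℕ → Type v) :
    Ultraproduct p (fun n => X n × Y n) ≃ Ultraproduct p X × Ultraproduct p Y where
  toFun z := (map p (fun _ => Prod.fst) z, map p (fun _ => Prod.snd) z)
  invFun w := map₂ p (fun _ => Prod.mk) w.1 w.2
  left_inv z := by
    induction z using ind
    rfl
  right_inv w := by
    obtain ⟨a, b⟩ := w
    induction a using ind
    induction b using ind
    rfl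

theorem prodEquiv_mk (p : Ultrafilter ℕ) {X : ℕ → Type u} {Y : ℕ → Type v}
    (s : ∀ n, X n × Y n) :
    prodEquiv p X Y (mk p s) = (mk p fun n => (s n).1, mk p fun n => (s n).2) := rfl

/-- The internal set `∏_{n → p} S n`: the class of `(s n)` belongs to it if and only if
`s n ∈ S n` for `p`-almost all `n`. -/
def internalSet (p : Ultrafilter ℕ) {X : ℕ → Type u} (S : ∀ n, Set (X n)) :
    Set (Ultraproduct p X) :=
  {x | Quotient.liftOn (s := productSetoid (p : Filter ℕ) X) x
    (fun s => ∀ᶠ n in (p : Filter ℕ), s n ∈ S n)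
    (fun s t h => by
      have h' : ∀ᶠ n in (p : Filter ℕ), s n = t n := h
      exact propext (eventually_congr (h'.mono fun n hn => by rw [hn])))}

theorem mk_mem_internalSet {p : Ultrafilter ℕ} {X : ℕ → Type u} {S : ∀ n, Set (X n)}
    {s : ∀ n, X n} : mk p s ∈ internalSet p S ↔ ∀ᶠ n in (p : Filter ℕ), s n ∈ S n :=
  Iff.rfl

/-- A subset of an ultraproduct is internal if it is of the form `∏_{n → p} S n`. -/
def IsInternal {p : Ultrafilter ℕ} {X : ℕ → Type u} (A : Set (Ultraproduct p X)) : Prop :=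
  ∃ S : ∀ n, Set (X n), A = internalSet p S

/-- The Loeb σ-algebra, generated by the internal sets. -/
instance instMeasurableSpace (p : Ultrafilter ℕ) (X : ℕ → Type u) :
    MeasurableSpace (Ultraproduct p X) :=
  MeasurableSpace.generateFrom {A | IsInternal A}

/-- The ultralimit of `|S n| / |X n|` as `n → p`, in the compact space `[0, ∞]`
(so the limit is the standard part of the hyperreal represented by the sequence). -/
noncomputable def ultraDensity (p : Ultrafilter ℕ) {X : ℕ → Type u} (S : ∀ n, Set (X n)) :
    ℝ≥0∞ :=
  limUnder (p : Filter ℕ) fun n => ((S n).ncard : ℝ≥0∞) / (Nat.card (X n) : ℝ≥0∞)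

theorem tendsto_ultraDensity (p : Ultrafilter ℕ) {X : ℕ → Type u} (S : ∀ n, Set (X n)) :
    Tendsto (fun n => ((S n).ncard : ℝ≥0∞) / (Nat.card (X n) : ℝ≥0∞)) (p : Filter ℕ)
      (𝓝 (ultraDensity p S)) := by
  refine tendsto_nhds_limUnder ?_
  obtain ⟨x, -, hx⟩ := isCompact_univ.ultrafilter_le_nhds
    (p.map fun n => ((S n).ncard : ℝ≥0∞) / (Nat.card (X n) : ℝ≥0∞)) (by simp)
  exact ⟨x, hx⟩

theorem ultraDensity_inter_add_diff (p : Ultrafilter ℕ) {X : ℕ → Type u} [∀ n, Finite (X n)]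
    (S T : ∀ n, Set (X n)) :
    ultraDensity p (fun n => T n ∩ S n) + ultraDensity p (fun n => T n \ S n)
      = ultraDensity p T := by
  refine tendsto_nhds_unique ((tendsto_ultraDensity p _).add (tendsto_ultraDensity p _))
    ((tendsto_ultraDensity p T).congr fun n => ?_)
  rw [← Set.ncard_inter_add_ncard_sdiff_eq_ncard (T n) (S n) (Set.toFinite _), Nat.cast_add,
    ENNReal.add_div]

/-- The premeasure `∏_{n → p} S n ↦ lim_{n → p} |S n| / |X n|` on internal sets
(with value `∞` on sets that are not internal). -/
noncomputable def loebPremeasure (p : Ultrafilter ℕ) {X : ℕ → Type u}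
    (A : Set (Ultraproduct p X)) : ℝ≥0∞ :=
  ⨅ (S : ∀ n, Set (X n)) (_ : A = internalSet p S), ultraDensity p S

theorem loebPremeasure_internalSet_le (p : Ultrafilter ℕ) {X : ℕ → Type u}
    (S : ∀ n, Set (X n)) : loebPremeasure p (internalSet p S) ≤ ultraDensity p S :=
  iInf₂_le (f := fun (T : ∀ n, Set (X n)) (_ : internalSet p S = internalSet p T) =>
    ultraDensity p T) S rfl

theorem loebPremeasure_empty (p : Ultrafilter ℕ) (X : ℕ → Type u) :
    loebPremeasure p (∅ : Set (Ultraproduct p X)) = 0 := by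
  have h : (∅ : Set (Ultraproduct p X)) = internalSet p fun _ => ∅ := by
    ext x
    induction x using ind
    simp [mk_mem_internalSet, p.neBot.ne]
  refine le_antisymm ?_ zero_le
  rw [h]
  refine (loebPremeasure_internalSet_le p _).trans (le_of_eq ?_)
  refine tendsto_nhds_unique (tendsto_ultraDensity p _) ?_
  simp

/-- The outer measure generated by the premeasure: the infimum of `∑ i, loebPremeasure (A i)` over
countable covers by internal sets `A i`. -/
noncomputable def loebOuterMeasure (p : Ultrafilter ℕ) (X : ℕ → Type u) :
    OuterMeasure (Ultraproduct p X) :=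
  OuterMeasure.ofFunction (loebPremeasure p) (loebPremeasure_empty p X)

theorem le_caratheodory_loebOuterMeasure (p : Ultrafilter ℕ) (X : ℕ → Type u)
    [∀ n, Finite (X n)] :
    instMeasurableSpace p X ≤ (loebOuterMeasure p X).caratheodory := by
  refine MeasurableSpace.generateFrom_le ?_
  rintro _ ⟨S, rfl⟩
  refine OuterMeasure.ofFunction_caratheodory fun t => le_iInf₂ ?_
  rintro T rfl
  have h₁ : internalSet p T ∩ internalSet p S = internalSet p fun n => T n ∩ S n := by
    ext x
    induction x using ind
    simp [mk_mem_internalSet]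
  have h₂ : internalSet p T \ internalSet p S = internalSet p fun n => T n \ S n := by
    ext x
    induction x using ind
    simp [mk_mem_internalSet]
  rw [h₁, h₂, ← ultraDensity_inter_add_diff p S T]
  exact add_le_add (loebPremeasure_internalSet_le p _) (loebPremeasure_internalSet_le p _)

/-- Loeb measure on the ultraproduct of a sequence of finite sets. -/
noncomputable def loebMeasure (p : Ultrafilter ℕ) (X : ℕ → Type u) [∀ n, Finite (X n)] :
    Measure (Ultraproduct p X) :=
  (loebOuterMeasure p X).toMeasure (le_caratheodory_loebOuterMeasure p X)

/-- Countable saturation. -/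
theorem exists_finite_subcover {p : Ultrafilter ℕ} (hp : ∀ n, p ≠ pure n) {X : ℕ → Type u}
    [∀ n, Nonempty (X n)] {S : ∀ n, Set (X n)} {T : ℕ → ∀ n, Set (X n)}
    (h : internalSet p S ⊆ ⋃ i, internalSet p (T i)) :
    ∃ N : ℕ, ∀ᶠ n in (p : Filter ℕ), ∀ x ∈ S n, ∃ i < N, x ∈ T i n := by
  classical
  by_contra hcon
  have hcof : (p : Filter ℕ) ≤ atTop := by
    rw [← Nat.cofinite_eq_atTop]
    rcases p.le_cofinite_or_eq_pure with h | ⟨n, h⟩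
    · exact h
    · exact absurd h (hp n)
  have hN : ∀ N : ℕ, ∀ᶠ n in (p : Filter ℕ), ∃ x ∈ S n, ∀ i < N, x ∉ T i n := by
    intro N
    have h1 : ¬ ∀ᶠ n in (p : Filter ℕ), ∀ x ∈ S n, ∃ i < N, x ∈ T i n :=
      fun h2 => hcon ⟨N, h2⟩
    filter_upwards [Ultrafilter.eventually_not.2 h1] with n hn
    push Not at hn
    exact hn
  let P : ℕ → ℕ → Prop := fun n N => ∃ x ∈ S n, ∀ i < N, x ∉ T i n
  let k : ℕ → ℕ := fun n => Nat.findGreatest (P n) n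
  have hx : ∀ n, ∃ x : X n, P n 0 → x ∈ S n ∧ ∀ i < k n, x ∉ T i n := by
    intro n
    by_cases h0 : P n 0
    · obtain ⟨x, hx, hx'⟩ : P n (k n) := Nat.findGreatest_spec (Nat.zero_le n) h0
      exact ⟨x, fun _ => ⟨hx, hx'⟩⟩
    · exact ⟨Classical.arbitrary _, fun h => absurd h h0⟩
  choose x hx using hx
  have hxS : mk p x ∈ internalSet p S := by
    rw [mk_mem_internalSet]
    filter_upwards [hN 0] with n hn using (hx n hn).1
  obtain ⟨i, hi⟩ := Set.mem_iUnion.1 (h hxS)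
  rw [mk_mem_internalSet] at hi
  have hbad : ∀ᶠ n in (p : Filter ℕ), False := by
    filter_upwards [hi, hN 0, hN (i + 1), hcof (eventually_ge_atTop (i + 1))]
      with n h1 h2 h3 h4
    exact (hx n h2).2 i (Nat.le_findGreatest h4 h3) h1
  exact hbad.exists.choose_spec

theorem ultraDensity_le_sum {p : Ultrafilter ℕ} {X : ℕ → Type u} [∀ n, Finite (X n)]
    {S : ∀ n, Set (X n)} {T : ℕ → ∀ n, Set (X n)} {N : ℕ}
    (h : ∀ᶠ n in (p : Filter ℕ), ∀ x ∈ S n, ∃ i < N, x ∈ T i n) :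
    ultraDensity p S ≤ ∑ i ∈ Finset.range N, ultraDensity p (T i) := by
  refine le_of_tendsto_of_tendsto (tendsto_ultraDensity p S)
    (tendsto_finsetSum _ fun i _ => tendsto_ultraDensity p (T i)) ?_
  filter_upwards [h] with n hn
  simp only [div_eq_mul_inv]
  rw [← Finset.sum_mul]
  gcongr
  have hsub : S n ⊆ ⋃ i ∈ Finset.range N, T i n := by
    intro x hx
    obtain ⟨i, hi, hxi⟩ := hn x hx
    simp only [Set.mem_iUnion]
    exact ⟨i, Finset.mem_range.2 hi, hxi⟩
  have := (Set.ncard_le_ncard hsub (Set.toFinite _)).trans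
    (Finset.set_ncard_biUnion_le (Finset.range N) fun i => T i n)
  exact_mod_cast this

theorem ultraDensity_mono {p : Ultrafilter ℕ} (hp : ∀ n, p ≠ pure n) {X : ℕ → Type u}
    [∀ n, Finite (X n)] [∀ n, Nonempty (X n)] {S T : ∀ n, Set (X n)}
    (h : internalSet p S ⊆ internalSet p T) : ultraDensity p S ≤ ultraDensity p T := by
  obtain ⟨N, hN⟩ := exists_finite_subcover hp (S := S) (T := fun _ => T)
    (h.trans (Set.subset_iUnion (fun _ : ℕ => internalSet p T) 0))
  have : ∀ᶠ n in (p : Filter ℕ), ∀ x ∈ S n, ∃ i < 1, x ∈ (fun _ : ℕ => T) i n := by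
    filter_upwards [hN] with n hn x hx
    obtain ⟨i, -, hi⟩ := hn x hx
    exact ⟨0, zero_lt_one, hi⟩
  simpa using ultraDensity_le_sum (T := fun _ : ℕ => T) this

/-- Loeb measure extends the premeasure: the measure of the internal set `∏_{n → p} S n` is the
ultralimit of `|S n| / |X n|`. -/
theorem loebMeasure_internalSet {p : Ultrafilter ℕ} (hp : ∀ n, p ≠ pure n) {X : ℕ → Type u}
    [∀ n, Finite (X n)] [∀ n, Nonempty (X n)] (S : ∀ n, Set (X n)) :
    loebMeasure p X (internalSet p S) = ultraDensity p S := by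
  have hmeas : MeasurableSet (internalSet p S) :=
    MeasurableSpace.measurableSet_generateFrom ⟨S, rfl⟩
  rw [loebMeasure, toMeasure_apply _ _ hmeas]
  refine le_antisymm ((OuterMeasure.ofFunction_le _).trans
    (loebPremeasure_internalSet_le p S)) ?_
  rw [loebOuterMeasure, OuterMeasure.ofFunction_apply]
  refine le_iInf₂ fun t ht => ?_
  by_cases hint : ∀ i, IsInternal (t i)
  · choose T hT using hint
    have ht' : internalSet p S ⊆ ⋃ i, internalSet p (T i) :=
      ht.trans (Set.iUnion_mono fun i => (hT i).subset)
    obtain ⟨N, hN⟩ := exists_finite_subcover hp ht'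
    refine (ultraDensity_le_sum hN).trans ((Finset.sum_le_sum fun i _ => ?_).trans
      (ENNReal.sum_le_tsum (Finset.range N)))
    refine le_iInf₂ fun T' hT' => ultraDensity_mono hp ?_
    rw [← hT', ← hT]
  · push Not at hint
    obtain ⟨i, hi⟩ := hint
    have : loebPremeasure p (t i) = ∞ := by
      rw [loebPremeasure, iInf_eq_top]
      intro S'
      rw [iInf_eq_top]
      exact fun h => absurd ⟨S', h⟩ hi
    exact le_top.trans (this.symm.le.trans (ENNReal.le_tsum i))

end Ultraproduct

open Ultraproduct in
/-- Ultrafinitary form: every ultrafinite group `G = ∏_{n → p} G n` has an internal normal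
subgroup `H` with `[H, H]` finite such that, for Loeb measure on `G² = ∏_{n → p} (G n)²`, almost
every pair `(x, y)` with `x⁻¹y⁻¹xy ∈ [H, H]` lies in `H²`. -/
def NeumannUltrafinitary : Prop :=
  ∀ (p : Ultrafilter ℕ), (∀ n, p ≠ pure n) →
    ∀ (G : ℕ → Type u) [∀ n, Group (G n)] [∀ n, Finite (G n)],
      ∃ H : Subgroup (Ultraproduct p G),
        H.Normal ∧ IsInternal (H : Set (Ultraproduct p G)) ∧
        ((⁅H, H⁆ : Subgroup (Ultraproduct p G)) : Set (Ultraproduct p G)).Finite ∧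
        ∀ᵐ z ∂(loebMeasure p fun n => G n × G n), ∀ x y : Ultraproduct p G,
          prodEquiv p G G z = (x, y) → x⁻¹ * y⁻¹ * x * y ∈ ⁅H, H⁆ → x ∈ H ∧ y ∈ H

/-- Finitary form: for every decreasing `η : ℕ → (0, 1)` there is `M` such that every finite
group `G` has a normal subgroup `H` with `|[H, H]| ≤ M` such that all but at most
`η(|[H, H]|) |G|²` of the pairs `(x, y)` with `x⁻¹y⁻¹xy ∈ [H, H]` lie in `H²`. -/
def NeumannFinitary : Prop :=
  ∀ η : ℕ → ℝ, Antitone η → (∀ n, 0 < η n ∧ η n < 1) →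
    ∃ M : ℕ, ∀ (G : Type u) [Group G] [Finite G],
      ∃ H : Subgroup G, H.Normal ∧ Nat.card (⁅H, H⁆ : Subgroup G) ≤ M ∧
        ({z : G × G | z.1⁻¹ * z.2⁻¹ * z.1 * z.2 ∈ ⁅H, H⁆ ∧ ¬(z.1 ∈ H ∧ z.2 ∈ H)}.ncard : ℝ)
          ≤ η (Nat.card (⁅H, H⁆ : Subgroup G)) * (Nat.card G : ℝ) ^ 2

/-! If `x` has more than `k` conjugates, then `[x, y] ∈ K` holds for at most `|K| |G| / k` elements
`y`, because it puts `y⁻¹ x y` into the coset `xK`. So if a normal subgroup `H` contains every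
element with at most `K` conjugates, its exceptional pairs number at most `2 |[H, H]| |G|² / K`
(`ncard_exceptionalPairs_mul_le`). What is needed is such an `H` with `|[H, H]|` bounded before `K`
is chosen.

Let `fcSet G k` be the set of elements with at most `k` conjugates. If its size does not double
between `k` and `k * K`, then every translate of it by an element of `fcSet G K` meets it, whence
`fcSet G K ⊆ fcSet G (k ^ 2)`. For `K ≥ k ^ 4` this makes `fcSet G (k ^ 2)` a normal subgroup `H`,
and B. H. Neumann's theorem bounds `|[H, H]|` in terms of `k` alone. Doubling cannot recur often
once `fcSet` has positive density; if the density is negligible, `H = ⊥` works. Each of the two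
forms is proved directly in this way, and the equivalence follows. -/

open scoped Pointwise commutatorElement

/-! ### Elements with boundedly many conjugates. -/

section FiniteConjugacy

variable {G : Type u} [Group G]

theorem ncard_conjugatesOf (x : G) :
    (conjugatesOf x).ncard = (Subgroup.centralizer {x}).index := by
  have h := MulAction.index_stabilizer (ConjAct G) (x : G)
  rw [ConjAct.stabilizer_eq_centralizer] at h
  rw [show conjugatesOf x = MulAction.orbit (ConjAct G) x by
    ext y; rw [ConjAct.mem_orbit_conjAct, isConj_comm]; rfl]
  exact h.symm

/-- The set of elements having at most `k` conjugates. -/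
def fcSet (G : Type u) [Group G] (k : ℕ) : Set G :=
  {x | (Subgroup.centralizer {x}).index ≤ k}

theorem mem_fcSet {k : ℕ} {x : G} : x ∈ fcSet G k ↔ (Subgroup.centralizer {x}).index ≤ k :=
  Iff.rfl

theorem fcSet_mono {k l : ℕ} (h : k ≤ l) : fcSet G k ⊆ fcSet G l :=
  fun _ hx => le_trans (mem_fcSet.1 hx) h

theorem one_mem_fcSet {k : ℕ} (hk : 1 ≤ k) : (1 : G) ∈ fcSet G k := by
  have : Subgroup.centralizer {(1 : G)} = ⊤ := by
    ext; simp [Subgroup.mem_centralizer_iff]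
  rw [mem_fcSet, this, Subgroup.index_top]
  exact hk

theorem inv_mem_fcSet {k : ℕ} {x : G} (hx : x ∈ fcSet G k) : x⁻¹ ∈ fcSet G k := by
  have : Subgroup.centralizer {x⁻¹} = Subgroup.centralizer {x} := by
    ext y
    simp only [Subgroup.mem_centralizer_singleton_iff]
    exact (Commute.inv_right_iff (a := y) (b := x))
  rwa [mem_fcSet, this]

theorem mul_mem_fcSet [Finite G] {k l : ℕ} {x y : G} (hx : x ∈ fcSet G k) (hy : y ∈ fcSet G l) :
    x * y ∈ fcSet G (k * l) := by
  have hle : Subgroup.centralizer {x} ⊓ Subgroup.centralizer {y} ≤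
      Subgroup.centralizer {x * y} := by
    intro z hz
    obtain ⟨hzx, hzy⟩ := Subgroup.mem_inf.1 hz
    rw [Subgroup.mem_centralizer_singleton_iff] at hzx hzy
    rw [Subgroup.mem_centralizer_singleton_iff]
    exact (show Commute z x from hzx).mul_right hzy
  exact (Nat.le_of_dvd (Nat.pos_of_ne_zero Subgroup.FiniteIndex.index_ne_zero)
    (Subgroup.index_dvd_of_le hle)).trans
    ((Subgroup.index_inf_le).trans (Nat.mul_le_mul hx hy))

theorem conj_mem_fcSet {k : ℕ} {x : G} (hx : x ∈ fcSet G k) (g : G) :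
    g * x * g⁻¹ ∈ fcSet G k := by
  rw [mem_fcSet, ← ncard_conjugatesOf] at hx ⊢
  rwa [← (isConj_iff.2 ⟨g, rfl⟩ : IsConj x (g * x * g⁻¹)).conjugatesOf_eq]

/-- The solutions `y` of `y * x * y⁻¹ = s` are empty or a coset of the centralizer of `x`. -/
theorem ncard_conj_mem_mul_index [Finite G] (x : G) (S : Set G) :
    {y : G | y * x * y⁻¹ ∈ S}.ncard * (Subgroup.centralizer {x}).index ≤ S.ncard * Nat.card G := by
  have h : {y : G | y * x * y⁻¹ ∈ S}.ncard ≤ S.ncard * Nat.card (Subgroup.centralizer {x}) := by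
    classical
    have : Fintype G := Fintype.ofFinite G
    rw [Set.ncard_eq_toFinset_card', Set.ncard_eq_toFinset_card', mul_comm]
    refine Finset.card_le_mul_card_image_of_maps_to (f := fun y => y * x * y⁻¹)
      (by simp) _ fun s _ => ?_
    rcases Finset.eq_empty_or_nonempty
      ({y ∈ {y : G | y * x * y⁻¹ ∈ S}.toFinset | y * x * y⁻¹ = s}) with h | ⟨z, hz⟩
    · rw [h]; simp
    · rw [← SetLike.coe_sort_coe, Nat.card_coe_set_eq, Set.ncard_eq_toFinset_card']
      refine Finset.card_le_card_of_injOn (fun y => z⁻¹ * y) (fun y hy => ?_)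
        (fun a _ b _ h => by simpa using h)
      simp only [Finset.mem_filter, Set.mem_toFinset, Set.mem_ofPred_eq, Finset.coe_filter] at hz hy
      simp only [Set.coe_toFinset, SetLike.mem_coe, Subgroup.mem_centralizer_singleton_iff]
      have := hy.2.trans hz.2.symm
      have h2 : y * x = z * x * z⁻¹ * y := by rw [← this]; group
      rw [mul_assoc, h2]; group
  calc _ ≤ S.ncard * Nat.card (Subgroup.centralizer {x}) * (Subgroup.centralizer {x}).index := by gcongr
    _ = _ := by rw [mul_assoc, Subgroup.card_mul_index]

/-! ### B. H. Neumann's theorem on groups with bounded conjugacy classes. -/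

/-- A bound for the number of commutators in a group all of whose conjugacy classes have at most
`k` elements. -/
theorem ncard_commutatorSet_le [Finite G] {k : ℕ} (h : ∀ x : G, x ∈ fcSet G k) :
    (commutatorSet G).ncard ≤ k ^ k * (k * k * k) := by
  classical
  have hconj (x : G) : (conjugatesOf x).ncard ≤ k := (ncard_conjugatesOf x).trans_le (h x)
  have hk : 1 ≤ k := (Nat.one_le_iff_ne_zero.2 Subgroup.FiniteIndex.index_ne_zero).trans (h (1 : G))
  -- A largest conjugacy class `A`, with conjugators `b z` taking `a` to each `z ∈ A`; `C`
  -- centralizes all of them.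
  obtain ⟨a, ha⟩ := Finite.exists_max fun x : G => (conjugatesOf x).ncard
  set A := conjugatesOf a with hA
  have hb (z : A) : ∃ b : G, b * a * b⁻¹ = z := isConj_iff.1 z.2
  choose b hb using hb
  have : Fintype A := Fintype.ofFinite A
  have (C : Subgroup G) : Fintype (G ⧸ C) := Fintype.ofFinite _
  set C : Subgroup G := ⨅ z : A, Subgroup.centralizer {b z} with hC
  have hCi : C.index ≤ k ^ k := by
    refine (Subgroup.index_iInf_le _).trans ((Finset.prod_le_pow_card _ _ k fun z _ => h _).trans ?_)
    rw [Finset.card_univ, ← Nat.card_eq_fintype_card]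
    exact Nat.pow_le_pow_right hk (hconj a)
  -- Conjugating `c⁻¹ * a` by `b z` gives `c⁻¹ * z`, so by maximality `c⁻¹ • A` is the whole class
  -- of `c⁻¹ * a`. Hence `y * (c⁻¹ * a) * y⁻¹ = c⁻¹ * z` for some `z ∈ A`, and `⁅c, y⁆` is `z` times
  -- the inverse of `y * a * y⁻¹`.
  have hcomm (c : G) (hc : c ∈ C) (y : G) : ⁅c, y⁆ ∈ A * A⁻¹ := by
    have hc' : c⁻¹ ∈ C := inv_mem hc
    have hsub : c⁻¹ • A ⊆ conjugatesOf (c⁻¹ * a) := by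
      rintro _ ⟨z, hz, rfl⟩
      have h1 := Subgroup.mem_iInf.1 hc' ⟨z, hz⟩
      rw [Subgroup.mem_centralizer_singleton_iff] at h1
      refine isConj_iff.2 ⟨b ⟨z, hz⟩, ?_⟩
      rw [← mul_assoc, ← h1, mul_assoc, mul_assoc, ← mul_assoc (b _), hb]
      rfl
    have heq : c⁻¹ • A = conjugatesOf (c⁻¹ * a) :=
      Set.eq_of_subset_of_ncard_le hsub (by rw [Set.ncard_smul_set]; exact ha _) (Set.toFinite _)
    have hy : y * (c⁻¹ * a) * y⁻¹ ∈ c⁻¹ • A := by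
      rw [heq]; exact isConj_iff.2 ⟨y, rfl⟩
    obtain ⟨z, hz, hzy⟩ := hy
    refine Set.mem_mul.2 ⟨z, hz, (y * a * y⁻¹)⁻¹, Set.inv_mem_inv.2 (isConj_iff.2 ⟨y, rfl⟩), ?_⟩
    have : z = c * (y * (c⁻¹ * a) * y⁻¹) := by rw [← hzy]; simp
    rw [this, commutatorElement_def]; group
  -- With `x = t * c`, `t` a coset representative and `c ∈ C`: `⁅x, y⁆ = t * ⁅c, y⁆ * (y * t⁻¹ *
  -- y⁻¹)`.
  have hcover : commutatorSet G ⊆ ⋃ q ∈ (Finset.univ : Finset (G ⧸ C)),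
      (q.out • (A * A⁻¹)) * conjugatesOf q.out⁻¹ := by
    rintro _ ⟨x, y, rfl⟩
    simp only [Set.mem_iUnion]
    refine ⟨(x : G ⧸ C), Finset.mem_univ _, ?_⟩
    set t := (x : G ⧸ C).out with ht
    have htx : t⁻¹ * x ∈ C := QuotientGroup.eq.1 (by rw [ht]; simp)
    refine Set.mem_mul.2 ⟨t * ⁅t⁻¹ * x, y⁆, ⟨_, hcomm _ htx y, rfl⟩, y * t⁻¹ * y⁻¹,
      isConj_iff.2 ⟨y, rfl⟩, ?_⟩
    simp only [commutatorElement_def]; group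
  have hmul (S T : Set G) : (S * T).ncard ≤ S.ncard * T.ncard := Set.natCard_mul_le
  calc _ ≤ _ := Set.ncard_le_ncard hcover (Set.toFinite _)
    _ ≤ _ := Finset.set_ncard_biUnion_le _ _
    _ ≤ ∑ q : G ⧸ C, k * k * k := by
      refine Finset.sum_le_sum fun q _ => (hmul _ _).trans ?_
      rw [Set.ncard_smul_set]
      refine Nat.mul_le_mul ((hmul _ _).trans ?_) (hconj _)
      rw [Set.ncard_inv]
      exact Nat.mul_le_mul (hconj a) (hconj a)
    _ ≤ _ := by
      rw [Finset.sum_const, Finset.card_univ, smul_eq_mul, ← Nat.card_eq_fintype_card]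
      exact Nat.mul_le_mul_right _ hCi

/-- A bound for the order of the derived subgroup of a group all of whose conjugacy classes have
at most `k` elements. -/
noncomputable def bfcBound (k : ℕ) : ℕ :=
  (Finset.range (k ^ k * (k * k * k) + 1)).sup Subgroup.cardCommutatorBound

theorem card_commutator_le_bfcBound [Finite G] {H : Subgroup G} {k : ℕ}
    (h : ∀ x ∈ H, x ∈ fcSet G k) : Nat.card (⁅H, H⁆ : Subgroup G) ≤ bfcBound k := by
  have h' (x : H) : x ∈ fcSet H k := by
    have hle : (Subgroup.centralizer {(x : G)}).subgroupOf H ≤ Subgroup.centralizer {x} := by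
      intro y hy
      rw [Subgroup.mem_subgroupOf, Subgroup.mem_centralizer_singleton_iff] at hy
      rw [Subgroup.mem_centralizer_singleton_iff]
      exact Subtype.ext hy
    have : ((Subgroup.centralizer {(x : G)}).subgroupOf H).index ≤
      (Subgroup.centralizer {(x : G)}).index := by
      rw [← Subgroup.relIndex_top_right (Subgroup.centralizer {(x : G)})]
      refine Subgroup.relIndex_le_of_le_right le_top ?_
      rw [Subgroup.relIndex_top_right]
      exact Subgroup.FiniteIndex.index_ne_zero
    exact (Nat.le_of_dvd (Nat.pos_of_ne_zero Subgroup.FiniteIndex.index_ne_zero)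
      (Subgroup.index_dvd_of_le hle)).trans (this.trans (h x x.2))
  rw [← Subgroup.map_subtype_commutator, Subgroup.card_map_of_injective H.subtype_injective]
  refine (Subgroup.card_commutator_le_of_finite_commutatorSet H).trans ?_
  -- The supremum in `bfcBound` makes monotonicity of `cardCommutatorBound` unnecessary.
  exact Finset.le_sup (f := Subgroup.cardCommutatorBound)
    (Finset.mem_range.2 (Nat.lt_succ_of_le (ncard_commutatorSet_le h')))

/-! ### Counting exceptional pairs. -/

/-- The pairs outside `H²` whose commutator lies in `⁅H, H⁆`. -/
def exceptionalPairs (H : Subgroup G) : Set (G × G) :=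
  {z | z.1⁻¹ * z.2⁻¹ * z.1 * z.2 ∈ ⁅H, H⁆ ∧ ¬(z.1 ∈ H ∧ z.2 ∈ H)}

theorem ncard_pairs_le [Finite G] (K : Subgroup G) (k : ℕ) :
    {z : G × G | z.1⁻¹ * z.2⁻¹ * z.1 * z.2 ∈ K ∧ z.1 ∉ fcSet G k}.ncard * k
      ≤ Nat.card K * Nat.card G ^ 2 := by
  classical
  have : Fintype G := Fintype.ofFinite G
  have hfib (x : G) (hx : x ∉ fcSet G k) :
      {y : G | x⁻¹ * y⁻¹ * x * y ∈ K}.ncard * k ≤ Nat.card K * Nat.card G := by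
    have h1 := ncard_conj_mem_mul_index x (x • (K : Set G))
    rw [Set.ncard_smul_set] at h1
    have h2 : {y : G | x⁻¹ * y⁻¹ * x * y ∈ K} = {y : G | y * x * y⁻¹ ∈ x • (K : Set G)}⁻¹ := by
      ext y
      simp [Set.mem_smul_set_iff_inv_smul_mem, mul_assoc]
    rw [h2, Set.ncard_inv]
    have h3 : k ≤ (Subgroup.centralizer {x}).index := (not_le.1 (mt mem_fcSet.2 hx)).le
    exact (Nat.mul_le_mul_left _ h3).trans h1
  have hsub : {z : G × G | z.1⁻¹ * z.2⁻¹ * z.1 * z.2 ∈ K ∧ z.1 ∉ fcSet G k} ⊆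
      ⋃ x ∈ (Finset.univ : Finset G).filter (fun x => x ∉ fcSet G k),
        Prod.mk x '' {y : G | x⁻¹ * y⁻¹ * x * y ∈ K} := by
    rintro ⟨x, y⟩ ⟨h1, h2⟩
    simp only [Set.mem_iUnion]
    exact ⟨x, by simpa using h2, y, h1, rfl⟩
  calc _ ≤ (∑ x ∈ (Finset.univ : Finset G).filter (fun x => x ∉ fcSet G k),
        (Prod.mk x '' {y : G | x⁻¹ * y⁻¹ * x * y ∈ K}).ncard) * k := by
        gcongr
        exact (Set.ncard_le_ncard hsub (Set.toFinite _)).trans (Finset.set_ncard_biUnion_le _ _)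
    _ ≤ ∑ x ∈ (Finset.univ : Finset G).filter (fun x => x ∉ fcSet G k),
        Nat.card K * Nat.card G := by
        rw [Finset.sum_mul]
        refine Finset.sum_le_sum fun x hx => ?_
        rw [Set.ncard_image_of_injective _ (Prod.mk_right_injective x)]
        exact hfib x (by simpa using hx)
    _ ≤ Nat.card G * (Nat.card K * Nat.card G) := by
        rw [Finset.sum_const, smul_eq_mul, Nat.card_eq_fintype_card (α := G)]
        gcongr
        exact Finset.card_filter_le _ _
    _ = _ := by ring

/-- One coordinate of an exceptional pair lies outside `H`, hence has more than `k` conjugates;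
since `[y, x] = [x, y]⁻¹`, the two cases are exchanged by `Prod.swap`. -/
theorem ncard_exceptionalPairs_mul_le [Finite G] {H : Subgroup G} {k : ℕ}
    (h : fcSet G k ⊆ H) :
    (exceptionalPairs H).ncard * k ≤ 2 * Nat.card (⁅H, H⁆ : Subgroup G) * Nat.card G ^ 2 := by
  set E := {z : G × G | z.1⁻¹ * z.2⁻¹ * z.1 * z.2 ∈ ⁅H, H⁆ ∧ z.1 ∉ fcSet G k} with hE
  have hsub : exceptionalPairs H ⊆ E ∪ Prod.swap '' E := by
    rintro ⟨x, y⟩ ⟨h1, h2⟩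
    by_cases hx : x ∈ H
    · refine Or.inr ⟨(y, x), ⟨?_, fun hy => h2 ⟨hx, h hy⟩⟩, rfl⟩
      simpa [mul_assoc] using inv_mem h1
    · exact Or.inl ⟨h1, fun hx' => hx (h hx')⟩
  have h1 : (exceptionalPairs H).ncard ≤ E.ncard + E.ncard := by
    refine (Set.ncard_le_ncard hsub (Set.toFinite _)).trans ((Set.ncard_union_le _ _).trans ?_)
    rw [Set.ncard_image_of_injective _ Prod.swap_injective]
  have h2 := ncard_pairs_le ⁅H, H⁆ k
  rw [← hE] at h2
  nlinarith

/-- Serves the case where `fcSet G k` has small density: a commuting pair either starts in that set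
or is counted by `ncard_pairs_le` with trivial `K`. -/
theorem ncard_exceptionalPairs_bot_mul_le [Finite G] (k : ℕ) :
    (exceptionalPairs (⊥ : Subgroup G)).ncard * k ≤
      (fcSet G k).ncard * Nat.card G * k + Nat.card G ^ 2 := by
  set E := {z : G × G | z.1⁻¹ * z.2⁻¹ * z.1 * z.2 ∈ (⊥ : Subgroup G) ∧ z.1 ∉ fcSet G k} with hE
  have hsub : exceptionalPairs (⊥ : Subgroup G) ⊆ E ∪ fcSet G k ×ˢ Set.univ := by
    rintro ⟨x, y⟩ ⟨h1, -⟩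
    rw [Subgroup.commutator_bot_left] at h1
    by_cases hx : x ∈ fcSet G k
    · exact Or.inr ⟨hx, trivial⟩
    · exact Or.inl ⟨h1, hx⟩
  have h1 : (exceptionalPairs (⊥ : Subgroup G)).ncard ≤ E.ncard + (fcSet G k).ncard * Nat.card G := by
    refine (Set.ncard_le_ncard hsub (Set.toFinite _)).trans ((Set.ncard_union_le _ _).trans ?_)
    rw [Set.ncard_prod, Set.ncard_univ]
  have h2 := ncard_pairs_le (⊥ : Subgroup G) k
  rw [← hE, Subgroup.card_bot] at h2
  nlinarith

/-! ### Absence of doubling produces a subgroup. -/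

/-- If the number of elements with few conjugates does not double between `k` and `k * K`, then
every element with at most `K` conjugates has at most `k ^ 2` conjugates. -/
theorem fcSet_subset_of_ncard_lt [Finite G] {k K : ℕ} (hK : 1 ≤ K)
    (h : (fcSet G (k * K)).ncard < 2 * (fcSet G k).ncard) : fcSet G K ⊆ fcSet G (k ^ 2) := by
  intro x hx
  have h1 : fcSet G k ⊆ fcSet G (k * K) := fcSet_mono (Nat.le_mul_of_pos_right _ hK)
  have h2 : x • fcSet G k ⊆ fcSet G (k * K) := by
    rintro _ ⟨y, hy, rfl⟩
    rw [mul_comm]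
    exact mul_mem_fcSet hx hy
  -- Two disjoint sets of this common size would not fit into `fcSet G (k * K)`.
  have h3 : ¬ Disjoint (fcSet G k) (x • fcSet G k) := by
    intro hd
    have := Set.ncard_le_ncard (Set.union_subset h1 h2) (Set.toFinite _)
    rw [Set.ncard_union_eq hd (Set.toFinite _) (Set.toFinite _), Set.ncard_smul_set] at this
    omega
  obtain ⟨z, hz, y, hy, hxy⟩ := Set.not_disjoint_iff.1 h3
  have : x = z * y⁻¹ := by rw [← hxy]; simp
  rw [this, pow_two]
  exact mul_mem_fcSet hz (inv_mem_fcSet hy)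

/-- If the number of elements with few conjugates does not double between `k` and `k * K` for some
`K ≥ k ^ 4`, then the elements with at most `k ^ 2` conjugates form a normal subgroup. -/
theorem exists_normal_eq_fcSet [Finite G] {k K : ℕ} (hk : 1 ≤ k) (hK : k ^ 4 ≤ K)
    (h : (fcSet G (k * K)).ncard < 2 * (fcSet G k).ncard) :
    ∃ H : Subgroup G, H.Normal ∧ (H : Set G) = fcSet G (k ^ 2) := by
  have hsub := fcSet_subset_of_ncard_lt ((Nat.one_le_pow _ _ hk).trans hK) h
  -- A product of two elements lies in `fcSet G (k ^ 4) ⊆ fcSet G K`, which falls back into `fcSet G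
  -- (k ^ 2)`.
  refine ⟨{ carrier := fcSet G (k ^ 2)
            one_mem' := one_mem_fcSet (Nat.one_le_pow _ _ hk)
            inv_mem' := inv_mem_fcSet
            mul_mem' := fun hx hy => hsub (fcSet_mono (le_trans (le_of_eq (by ring)) hK)
              (mul_mem_fcSet hx hy)) }, ⟨fun x hx g => conj_mem_fcSet hx g⟩, rfl⟩

end FiniteConjugacy

/-! ### The finitary form. -/

section Finitary

theorem neumannFinitary : NeumannFinitary.{u} := by
  intro η hη hη01
  -- The value `η 1` is the one relevant to `H = ⊥`. Half of it pays for pairs with `x ∈ fcSet G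
  -- k₀`, half (`1 / k₀`) for the rest.
  obtain ⟨k₀, hk₀⟩ := exists_nat_ge (2 / η 1)
  have hη1 := (hη01 1).1
  have hk₀pos : 1 ≤ k₀ := by
    have : (0 : ℝ) < k₀ := (by positivity : 0 < 2 / η 1).trans_le hk₀
    exact_mod_cast this
  -- `K` is chosen after the bound `B` on `|[H, H]|`, so that `2 * B / K ≤ η B`; monotonicity of `η`
  -- passes to the true order.
  have hK (k : ℕ) : ∃ K : ℕ, k ^ 4 ≤ K ∧ 2 * (bfcBound (k ^ 2) : ℝ) ≤ K * η (bfcBound (k ^ 2)) := by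
    obtain ⟨K, hK⟩ := exists_nat_ge (2 * (bfcBound (k ^ 2) : ℝ) / η (bfcBound (k ^ 2)))
    refine ⟨max (k ^ 4) K, le_max_left _ _, ?_⟩
    rw [← div_le_iff₀ (hη01 _).1]
    exact hK.trans (by exact_mod_cast le_max_right _ _)
  choose K hK4 hKη using hK
  set k : ℕ → ℕ := fun i => (fun j => j * K j)^[i] k₀ with hk
  have hk_succ (i : ℕ) : k (i + 1) = k i * K (k i) := Function.iterate_succ_apply' _ _ _
  have hK1 {j : ℕ} (hj : 1 ≤ j) : 1 ≤ K j := (Nat.one_le_pow _ _ hj).trans (hK4 j)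
  have hk1 (i : ℕ) : 1 ≤ k i := by
    induction i with
    | zero => exact hk₀pos
    | succ i ih => rw [hk_succ]; exact Nat.mul_pos ih (hK1 ih)
  -- Starting from density above `η 1 / 2`, `L` doublings would push the density past `1`.
  obtain ⟨L, hL⟩ := pow_unbounded_of_one_lt (2 / η 1) (one_lt_two (α := ℝ))
  refine ⟨max 1 ((Finset.range L).sup fun i => bfcBound (k i ^ 2)), fun G _ _ => ?_⟩
  have hGpos : (0 : ℝ) < Nat.card G := by exact_mod_cast Nat.card_pos
  rcases le_or_gt ((fcSet G k₀).ncard : ℝ) (η 1 / 2 * Nat.card G) with hsmall | hlarge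
  · refine ⟨⊥, inferInstance, ?_, ?_⟩
    · rw [Subgroup.commutator_bot_left, Subgroup.card_bot]
      exact le_max_left _ _
    · have hcard : Nat.card (⁅(⊥ : Subgroup G), (⊥ : Subgroup G)⁆ : Subgroup G) = 1 := by
        rw [Subgroup.commutator_bot_left, Subgroup.card_bot]
      rw [hcard]
      change ((exceptionalPairs (⊥ : Subgroup G)).ncard : ℝ) ≤ _
      have h1 : ((exceptionalPairs (⊥ : Subgroup G)).ncard : ℝ) * k₀ ≤
          (fcSet G k₀).ncard * Nat.card G * k₀ + Nat.card G ^ 2 := by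
        exact_mod_cast ncard_exceptionalPairs_bot_mul_le (G := G) k₀
      have hk₀' : (0 : ℝ) < k₀ := by exact_mod_cast hk₀pos
      rw [div_le_iff₀ hη1] at hk₀
      refine le_of_mul_le_mul_right (h1.trans ?_) hk₀'
      have h2 : ((fcSet G k₀).ncard : ℝ) * Nat.card G * k₀ ≤
          η 1 / 2 * Nat.card G * Nat.card G * k₀ := by gcongr
      have h3 : 2 * (Nat.card G : ℝ) ^ 2 ≤ k₀ * η 1 * Nat.card G ^ 2 := by gcongr
      nlinarith
  · obtain ⟨i, hiL, hi⟩ : ∃ i < L, (fcSet G (k (i + 1))).ncard < 2 * (fcSet G (k i)).ncard := by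
      by_contra! hcon
      have hgrow (j : ℕ) (hj : j ≤ L) : 2 ^ j * (fcSet G k₀).ncard ≤ (fcSet G (k j)).ncard := by
        induction j with
        | zero => simp [hk]
        | succ j ih =>
          rw [pow_succ', mul_assoc]
          exact (Nat.mul_le_mul_left 2 (ih (by omega))).trans (hcon j (by omega))
      have h1 : (2 : ℝ) ^ L * (fcSet G k₀).ncard ≤ Nat.card G := by
        exact_mod_cast (hgrow L le_rfl).trans (Set.ncard_le_card _)
      have h2 : 2 / η 1 * (η 1 / 2 * Nat.card G) < 2 ^ L * (fcSet G k₀).ncard :=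
        mul_lt_mul'' hL hlarge (by positivity) (by positivity)
      have h3 : 2 / η 1 * (η 1 / 2 * Nat.card G) = Nat.card G := by field_simp
      linarith
    rw [hk_succ] at hi
    obtain ⟨H, hHn, hH⟩ := exists_normal_eq_fcSet (hk1 i) (hK4 _) hi
    have hsub : fcSet G (K (k i)) ⊆ H := hH ▸ fcSet_subset_of_ncard_lt (hK1 (hk1 i)) hi
    have hm : Nat.card (⁅H, H⁆ : Subgroup G) ≤ bfcBound (k i ^ 2) :=
      card_commutator_le_bfcBound fun x hx => hH.subset hx
    refine ⟨H, hHn, hm.trans (le_max_of_le_right ?_), ?_⟩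
    · exact Finset.le_sup (f := fun i => bfcBound (k i ^ 2)) (Finset.mem_range.2 hiL)
    · change ((exceptionalPairs H).ncard : ℝ) ≤ _
      have h1 : ((exceptionalPairs H).ncard : ℝ) * K (k i) ≤
          2 * Nat.card (⁅H, H⁆ : Subgroup G) * Nat.card G ^ 2 := by
        exact_mod_cast ncard_exceptionalPairs_mul_le hsub
      have hKpos : (0 : ℝ) < K (k i) := by exact_mod_cast hK1 (hk1 i)
      refine le_of_mul_le_mul_right (h1.trans ?_) hKpos
      have h2 : 2 * (Nat.card (⁅H, H⁆ : Subgroup G) : ℝ) ≤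
          K (k i) * η (Nat.card (⁅H, H⁆ : Subgroup G)) :=
        calc _ ≤ 2 * (bfcBound (k i ^ 2) : ℝ) := by gcongr
          _ ≤ _ := hKη _
          _ ≤ _ := by gcongr; exact hη hm
      calc _ ≤ K (k i) * η (Nat.card (⁅H, H⁆ : Subgroup G)) * (Nat.card G : ℝ) ^ 2 := by gcongr
        _ = _ := by ring

end Finitary

/-! ### Transfer to the ultraproduct. -/

namespace Ultraproduct

variable {p : Ultrafilter ℕ}

theorem mk_surjective (p : Ultrafilter ℕ) (X : ℕ → Type u) :
    Function.Surjective (mk p : (∀ n, X n) → Ultraproduct p X) :=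
  fun x => ind (P := fun x => ∃ s, mk p s = x) (fun s => ⟨s, rfl⟩) x

theorem ultraDensity_eq_zero {X : ℕ → Type u} [∀ n, Finite (X n)] [∀ n, Nonempty (X n)]
    {S : ∀ n, Set (X n)} (c : ℕ)
    (h : ∀ N : ℕ, ∀ᶠ n in (p : Filter ℕ), (S n).ncard * N ≤ c * Nat.card (X n)) :
    ultraDensity p S = 0 := by
  have hlim : Tendsto (fun N : ℕ => (c : ℝ≥0∞) / N) atTop (𝓝 0) := by
    have := ENNReal.Tendsto.const_div (a := (c : ℝ≥0∞)) ENNReal.tendsto_nat_nhds_top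
      (Or.inr (ENNReal.natCast_ne_top c))
    rwa [ENNReal.div_top] at this
  refine le_antisymm (ge_of_tendsto hlim ?_) zero_le
  filter_upwards [eventually_ge_atTop 1] with N hN
  refine le_of_tendsto (tendsto_ultraDensity p S) ?_
  filter_upwards [h N] with n hn
  have hX : (Nat.card (X n) : ℝ≥0∞) ≠ 0 := by exact_mod_cast Nat.card_pos.ne'
  have hN0 : (N : ℝ≥0∞) ≠ 0 := by exact_mod_cast (Nat.one_le_iff_ne_zero.1 hN)
  rw [ENNReal.div_le_iff hX (ENNReal.natCast_ne_top _), ← ENNReal.mul_div_right_comm,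
    ENNReal.le_div_iff_mul_le (Or.inl hN0) (Or.inl (ENNReal.natCast_ne_top _))]
  exact_mod_cast hn

/-- An internal set defined by sets of bounded size is finite. -/
theorem finite_internalSet {X : ℕ → Type u} [∀ n, Finite (X n)] {S : ∀ n, Set (X n)} (m : ℕ)
    (h : ∀ᶠ n in (p : Filter ℕ), (S n).ncard ≤ m) : (internalSet p S).Finite := by
  by_contra hinf
  obtain ⟨t, ht, htc⟩ := Set.Infinite.exists_subset_card_eq hinf (m + 1)
  choose r hr using mk_surjective p X
  have hmem : ∀ᶠ n in (p : Filter ℕ), ∀ x ∈ t, r x n ∈ S n := by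
    rw [Filter.eventually_all_finset]
    intro x hx
    rw [← mk_mem_internalSet (p := p), hr]
    exact ht hx
  -- Representatives of `m + 1` distinct classes are pairwise distinct at `p`-almost every index.
  have hinj : ∀ᶠ n in (p : Filter ℕ), ∀ x ∈ t, ∀ y ∈ t, r x n = r y n → x = y := by
    rw [Filter.eventually_all_finset]
    intro x _
    rw [Filter.eventually_all_finset]
    intro y _
    by_cases hxy : x = y
    · simp [hxy]
    · have : ¬ ∀ᶠ n in (p : Filter ℕ), r x n = r y n := by
        rwa [← mk_eq_mk, hr, hr]
      filter_upwards [Ultrafilter.eventually_not.2 this] with n hn h using absurd h hn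
  obtain ⟨n, h1, h2, h3⟩ := (h.and (hmem.and hinj)).exists
  have := Set.ncard_le_ncard_of_injOn (s := (t : Set (Ultraproduct p X))) (fun x => r x n)
    (fun x hx => h2 x hx) (fun x hx y hy => h3 x hx y hy) (Set.toFinite (S n))
  rw [Set.ncard_coe_finset, htc] at this
  omega

/-- The internal subgroup `∏_{n → p} H n`. -/
def internalSubgroup (p : Ultrafilter ℕ) {G : ℕ → Type u} [∀ n, Group (G n)]
    (H : ∀ n, Subgroup (G n)) : Subgroup (Ultraproduct p G) where
  carrier := internalSet p fun n => (H n : Set (G n))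
  one_mem' := by
    rw [mk_one, mk_mem_internalSet]
    exact Eventually.of_forall fun n => one_mem _
  mul_mem' {x y} hx hy := by
    obtain ⟨s, rfl⟩ := mk_surjective p G x
    obtain ⟨t, rfl⟩ := mk_surjective p G y
    rw [mk_mul, mk_mem_internalSet]
    filter_upwards [mk_mem_internalSet.1 hx, mk_mem_internalSet.1 hy] with n h1 h2
    exact mul_mem h1 h2
  inv_mem' {x} hx := by
    obtain ⟨s, rfl⟩ := mk_surjective p G x
    rw [mk_inv, mk_mem_internalSet]
    filter_upwards [mk_mem_internalSet.1 hx] with n h1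
    exact inv_mem h1

variable {G : ℕ → Type u} [∀ n, Group (G n)]

theorem mk_mem_internalSubgroup {H : ∀ n, Subgroup (G n)} {s : ∀ n, G n} :
    mk p s ∈ internalSubgroup p H ↔ ∀ᶠ n in (p : Filter ℕ), s n ∈ H n :=
  Iff.rfl

theorem normal_internalSubgroup {H : ∀ n, Subgroup (G n)} (hH : ∀ n, (H n).Normal) :
    (internalSubgroup p H).Normal := by
  refine ⟨fun x hx g => ?_⟩
  obtain ⟨s, rfl⟩ := mk_surjective p G x
  obtain ⟨t, rfl⟩ := mk_surjective p G g
  rw [mk_inv, mk_mul, mk_mul, mk_mem_internalSubgroup]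
  filter_upwards [mk_mem_internalSubgroup.1 hx] with n hn using (hH n).conj_mem _ hn _

/-- This inclusion suffices: finiteness and the null exceptional set both pass to the smaller
commutator subgroup. -/
theorem commutator_internalSubgroup_le (H : ∀ n, Subgroup (G n)) :
    ⁅internalSubgroup p H, internalSubgroup p H⁆ ≤ internalSubgroup p fun n => ⁅H n, H n⁆ := by
  rw [Subgroup.commutator_le]
  intro x hx y hy
  obtain ⟨s, rfl⟩ := mk_surjective p G x
  obtain ⟨t, rfl⟩ := mk_surjective p G y
  rw [commutatorElement_def, mk_inv, mk_inv, mk_mul, mk_mul, mk_mul, mk_mem_internalSubgroup]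
  filter_upwards [mk_mem_internalSubgroup.1 hx, mk_mem_internalSubgroup.1 hy] with n h1 h2
  exact Subgroup.commutator_mem_commutator h1 h2

variable [∀ n, Finite (G n)]

/-- The bad pairs lie in the internal set of the `exceptionalPairs (H n)`, whose density is at most
`c / N` for every positive `N`. -/
theorem ae_mem_internalSubgroup (hp : ∀ n, p ≠ pure n) {H : ∀ n, Subgroup (G n)} (c : ℕ)
    (h : ∀ N : ℕ, ∀ᶠ n in (p : Filter ℕ),
      (exceptionalPairs (H n)).ncard * N ≤ c * Nat.card (G n) ^ 2) :
    ∀ᵐ z ∂(loebMeasure p fun n => G n × G n), ∀ x y : Ultraproduct p G,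
      prodEquiv p G G z = (x, y) →
        x⁻¹ * y⁻¹ * x * y ∈ ⁅internalSubgroup p H, internalSubgroup p H⁆ →
          x ∈ internalSubgroup p H ∧ y ∈ internalSubgroup p H := by
  have hnull : loebMeasure p (fun n => G n × G n)
      (internalSet p fun n => exceptionalPairs (H n)) = 0 := by
    rw [loebMeasure_internalSet hp]
    refine ultraDensity_eq_zero c fun N => (h N).mono fun n hn => ?_
    rwa [Nat.card_prod, ← pow_two]
  refine measure_mono_null ?_ hnull
  intro z hz
  contrapose! hz
  simp only [Set.mem_compl_iff, not_not]
  obtain ⟨s, rfl⟩ := mk_surjective p _ z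
  intro x y hxy hK
  rw [prodEquiv_mk, Prod.mk.injEq] at hxy
  obtain ⟨rfl, rfl⟩ := hxy
  have hK' := commutator_internalSubgroup_le H hK
  simp only [mk_inv, mk_mul, mk_mem_internalSubgroup] at hK'
  rw [mk_mem_internalSet, ← Ultrafilter.eventually_not] at hz
  rw [mk_mem_internalSubgroup, mk_mem_internalSubgroup, ← Filter.eventually_and]
  filter_upwards [hK', hz] with n h1 h2
  by_contra h3
  exact h2 ⟨h1, h3⟩

theorem neumannUltrafinitary_of_bounds (hp : ∀ n, p ≠ pure n) (H : ∀ n, Subgroup (G n))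
    (hH : ∀ n, (H n).Normal) (m c : ℕ)
    (hm : ∀ᶠ n in (p : Filter ℕ), Nat.card (⁅H n, H n⁆ : Subgroup (G n)) ≤ m)
    (h : ∀ N : ℕ, ∀ᶠ n in (p : Filter ℕ),
      (exceptionalPairs (H n)).ncard * N ≤ c * Nat.card (G n) ^ 2) :
    ∃ H : Subgroup (Ultraproduct p G),
      H.Normal ∧ IsInternal (H : Set (Ultraproduct p G)) ∧
      ((⁅H, H⁆ : Subgroup (Ultraproduct p G)) : Set (Ultraproduct p G)).Finite ∧
      ∀ᵐ z ∂(loebMeasure p fun n => G n × G n), ∀ x y : Ultraproduct p G,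
        prodEquiv p G G z = (x, y) → x⁻¹ * y⁻¹ * x * y ∈ ⁅H, H⁆ → x ∈ H ∧ y ∈ H :=
  ⟨internalSubgroup p H, normal_internalSubgroup hH, ⟨_, rfl⟩,
    (finite_internalSet m hm).subset (commutator_internalSubgroup_le H),
    ae_mem_internalSubgroup hp c h⟩

/-- If for some `k` the elements with at most `k` conjugates have positive density, then for some
`k` multiplying the number of conjugates by any constant does not double this density. -/
theorem exists_forall_eventually_ncard_lt {k₀ N : ℕ} (hk₀ : 1 ≤ k₀)
    (h : ∀ᶠ n in (p : Filter ℕ), Nat.card (G n) < (fcSet (G n) k₀).ncard * N) :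
    ∃ k, 1 ≤ k ∧ ∀ K, 1 ≤ K → ∀ᶠ n in (p : Filter ℕ),
      (fcSet (G n) (k * K)).ncard < 2 * (fcSet (G n) k).ncard := by
  by_contra! hcon
  have hgrow (L : ℕ) : ∃ k, 1 ≤ k ∧ ∀ᶠ n in (p : Filter ℕ),
      2 ^ L * Nat.card (G n) < (fcSet (G n) k).ncard * N := by
    induction L with
    | zero => exact ⟨k₀, hk₀, by simpa using h⟩
    | succ L ih =>
      obtain ⟨k, hk, hL⟩ := ih
      obtain ⟨K, hK, hn⟩ := hcon k hk
      refine ⟨k * K, Nat.mul_pos hk hK, ?_⟩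
      filter_upwards [hL, hn] with n h1 h2
      calc 2 ^ (L + 1) * Nat.card (G n) = 2 * (2 ^ L * Nat.card (G n)) := by ring
        _ < 2 * ((fcSet (G n) k).ncard * N) := by omega
        _ = 2 * (fcSet (G n) k).ncard * N := by ring
        _ ≤ _ := Nat.mul_le_mul_right _ h2
  -- `N` doublings suffice because `N ≤ 2 ^ N`.
  obtain ⟨k, -, hk⟩ := hgrow N
  obtain ⟨n, hn⟩ := hk.exists
  have h1 : (fcSet (G n) k).ncard ≤ Nat.card (G n) := Set.ncard_le_card _
  have h2 := (Nat.lt_two_pow_self (n := N)).le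
  have := Nat.mul_le_mul h2 h1
  rw [mul_comm (fcSet _ _).ncard] at hn
  omega

end Ultraproduct

/-! ### The ultrafinitary form. -/

open Ultraproduct in
theorem neumannUltrafinitary : NeumannUltrafinitary.{u} := by
  classical
  intro p hp G _ _
  by_cases hzero : ∀ k N : ℕ, ∀ᶠ n in (p : Filter ℕ),
      (fcSet (G n) k).ncard * N ≤ Nat.card (G n)
  -- Every `fcSet` has density zero. The constant `2` counts `|G|²` for pairs with `x ∈ fcSet` and
  -- `|G|²` for the others.
  · refine neumannUltrafinitary_of_bounds hp (fun n => ⊥) (fun n => inferInstance) 1 2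
      (Eventually.of_forall fun n => ?_) fun N => ?_
    · rw [Subgroup.commutator_bot_left, Subgroup.card_bot]
    · filter_upwards [hzero N N] with n hn
      have := ncard_exceptionalPairs_bot_mul_le (G := G n) N
      nlinarith
  · push Not at hzero
    obtain ⟨k₀, N, h⟩ := hzero
    -- Passing to `k₀ + 1` excludes the value `0`.
    have h' : ∀ᶠ n in (p : Filter ℕ),
        Nat.card (G n) < (fcSet (G n) (k₀ + 1)).ncard * N := by
      filter_upwards [h] with n hn
      exact hn.trans_le (Nat.mul_le_mul_right _
        (Set.ncard_le_ncard (fcSet_mono (Nat.le_succ _)) (Set.toFinite _)))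
    obtain ⟨k, hk, hK⟩ := exists_forall_eventually_ncard_lt (Nat.le_add_left 1 k₀) h'
    -- At the `p`-negligible indices where doubling occurs, `⊥` is a default value.
    have hex (n : ℕ) : ∃ H : Subgroup (G n), H.Normal ∧
        ((fcSet (G n) (k * k ^ 4)).ncard < 2 * (fcSet (G n) k).ncard →
          (H : Set (G n)) = fcSet (G n) (k ^ 2)) := by
      by_cases hn : (fcSet (G n) (k * k ^ 4)).ncard < 2 * (fcSet (G n) k).ncard
      · obtain ⟨H, h1, h2⟩ := exists_normal_eq_fcSet hk le_rfl hn
        exact ⟨H, h1, fun _ => h2⟩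
      · exact ⟨⊥, inferInstance, fun h => absurd h hn⟩
    choose H hHn hH using hex
    have hH' : ∀ᶠ n in (p : Filter ℕ), (H n : Set (G n)) = fcSet (G n) (k ^ 2) :=
      (hK _ (Nat.one_le_pow _ _ hk)).mono hH
    have hm : ∀ᶠ n in (p : Filter ℕ),
        Nat.card (⁅H n, H n⁆ : Subgroup (G n)) ≤ bfcBound (k ^ 2) :=
      hH'.mono fun n hn => card_commutator_le_bfcBound fun x hx => hn.subset hx
    refine neumannUltrafinitary_of_bounds hp H hHn _ (2 * bfcBound (k ^ 2)) hm fun N => ?_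
    -- `k`, and with it `H`, was fixed before `N`, so `H n` absorbs `fcSet (G n) N` for each `N`
    -- almost everywhere; `N + 1` ensures a positive factor.
    filter_upwards [hH', hm, hK (N + 1) (Nat.le_add_left 1 N)] with n h1 h2 h3
    have h4 : fcSet (G n) N ⊆ H n := by
      rw [h1]
      exact (fcSet_mono (Nat.le_succ N)).trans
        (fcSet_subset_of_ncard_lt (Nat.le_add_left 1 N) h3)
    refine (ncard_exceptionalPairs_mul_le h4).trans ?_
    gcongr

theorem mainTheorem12 :
    NeumannUltrafinitary.{u} ∧ (NeumannUltrafinitary.{u} ↔ NeumannFinitary.{u}) :=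
  ⟨neumannUltrafinitary, fun _ => neumannFinitary, fun _ => neumannUltrafinitary⟩
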